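/- Let $n\ge 1$, let $du$ be the spherical Lebesgue measure on $S^{n-1}\subset\mathbb R^n$, and let $\phi,\varphi$ be real functions on $(0,\infty)$ such that A1) $\phi:(0,\infty)\to(0,\infty)$ is strictly decreasing with $\lim_{t\to0^+}\phi(t)=\infty$ and $\lim_{t\to\infty}\phi(t)=0$; A2) $\phi'$ exists and is strictly negative on $(0,\infty)$; A3) $\varphi(t)=-\phi'(t)\,t$ is continuous on $(0,\infty)$. For a convex body $K\subset\mathbb R^n$ (compact, convex) with the origin in its interior and $u\in S^{n-1}$, put $h_K(u)=\max\{x\cdot u:x\in K\}$, $\rho_K(u)=\max\{\lambda:\lambda u\in K\}$ and $H(K,u)=\{x: x\cdot u=h_K(u)\}$, and for $\eta\subset S^{n-1}$ put $\boldsymbol\alpha_K^*(\eta)=\{x/|x|: x\in\partial K\cap H(K,u)\text{ for some }u\in\eta\}$. Let $$\widetilde V_\phi(K)=\frac1n\int_{S^{n-1}}\phi(\rho_K(u))\,du,$$ and let $\widetilde C_\varphi(K,\cdot)$ be the Borel measure on $S^{n-1}$ with $$\widetilde C_\varphi(K,\eta)=\frac1n\int_{\boldsymbol\alpha_K^*(\eta)}\varphi(\rho_K(u))\,du\qquad\text{for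 every Borel set }\eta\subset S^{n-1}.$$ Let $\Omega\subset S^{n-1}$ be a closed set that is not contained in any closed hemisphere, and let $g:\Omega\to\mathbb R$ be continuous. Let $\delta>0$ and, for $t\in(-\delta,\delta)$, let $h_t:\Omega\to(0,\infty)$ be continuous with $$\log h_t(v)=\log h_0(v)+t\,g(v)+o(t,v)\qquad(v\in\Omega),$$ where $o(t,\cdot)/t\to0$ uniformly on $\Omega$ as $t\to0$. Let $[h_t]=\bigcap_{u\in\Omega}\{x\in\mathbb R^n:x\cdot u\le h_t(u)\}$ be the Wulff shape of $h_t$. Then these objects are well defined (each $[h_t]$ is a convex body with the origin in its interior, $\phi\circ\rho_{[h_t]}$ is integrable on $S^{n-1}$, the sets $\boldsymbol\alpha^*_{[h_0]}(\eta)$ with $\eta$ Borel are spherically measurable and the formula above does define a Borel measure $\widetilde C_\varphi([h_0],\cdot)$, for which $g$ is integrable on $\Omega$, and $\widetilde V_\phi([h_0])>0$), and $$\lim_{t\to0}\frac{\widetilde V_\phi([h_t])-\widetilde V_\phi([h_0])}{t}=-\int_\Omega g(u)\,d\widetilde C_\varphi([h_0],u).$$ Moreover, $$\frac{d}{dt}\log\widetilde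 V_\phi([h_t])\Big|_{t=0}=\frac{-1}{\widetilde V_\phi([h_0])}\int_\Omega g(u)\,d\widetilde C_\varphi([h_0],u).$$ -/

import Mathlib

open MeasureTheory Set Filter Topology

noncomputable section

namespace DualOrlicz

/-- Euclidean space `ℝⁿ`. -/
abbrev E (n : ℕ) : Type := EuclideanSpace ℝ (Fin n)

/-- The unit sphere `S^{n-1}` of `ℝⁿ`. -/
abbrev Sph (n : ℕ) : Type := Metric.sphere (0 : E n) 1

/-- The spherical Lebesgue measure `du` on `S^{n-1}`; the measure of a Borel set `A` is `n` times
the volume of the cone `{r u : 0 < r < 1, u ∈ A}`. -/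
def sphMeasure (n : ℕ) : Measure (Sph n) := (volume : Measure (E n)).toSphere

variable {n : ℕ}

/-- The class of convex bodies with the origin in their interior. -/
structure IsConvexBodyO (K : Set (E n)) : Prop where
  convex : Convex ℝ K
  isCompact : IsCompact K
  zero_mem_interior : (0 : E n) ∈ interior K

/-- Support function `h_K(u) = max {x · u : x ∈ K}`. -/
def supportFn (K : Set (E n)) (u : Sph n) : ℝ :=
  sSup {s : ℝ | ∃ x ∈ K, s = inner ℝ x (u : E n)}

/-- Radial function `ρ_K(u) = max {r : r u ∈ K}`. -/
def radialFn (K : Set (E n)) (u : Sph n) : ℝ :=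
  sSup {r : ℝ | r • (u : E n) ∈ K}

/-- Supporting hyperplane `H(K, u) = {x : x · u = h_K(u)}`. -/
def supportHyperplane (K : Set (E n)) (u : Sph n) : Set (E n) :=
  {x | inner ℝ x (u : E n) = supportFn K u}

/-- Reverse radial Gauss image
`α*_K(η) = {x / |x| : x ∈ ∂K ∩ H(K, u) for some u ∈ η} ⊆ S^{n-1}`. -/
def reverseRadialGaussImage (K : Set (E n)) (η : Set (Sph n)) : Set (Sph n) :=
  {v | ∃ u ∈ η, ∃ x ∈ frontier K ∩ supportHyperplane K u, (v : E n) = ‖x‖⁻¹ • x}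

/-- Dual Orlicz quermassintegral `(1/n) ∫_{S^{n-1}} ϕ(ρ_K(u)) du`. -/
def dualQuermassintegral (ϕ : ℝ → ℝ) (K : Set (E n)) : ℝ :=
  (1 / (n : ℝ)) * ∫ u, ϕ (radialFn K u) ∂(sphMeasure n)

/-- `μ` is the dual Orlicz curvature measure of `K`: for each Borel set `η ⊆ S^{n-1}`, the set
`α*_K(η)` is spherically measurable and `μ(η) = (1/n) ∫_{α*_K(η)} φ(ρ_K(u)) du`. -/
def IsDualCurvatureMeasure (φ : ℝ → ℝ) (K : Set (E n)) (μ : Measure (Sph n)) : Prop :=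
  ∀ η : Set (Sph n), MeasurableSet η →
    NullMeasurableSet (reverseRadialGaussImage K η) (sphMeasure n) ∧
    μ η = (n : ENNReal)⁻¹ *
      ∫⁻ u in reverseRadialGaussImage K η, ENNReal.ofReal (φ (radialFn K u)) ∂(sphMeasure n)

open Classical in
/-- The dual Orlicz curvature measure of `K`, i.e. the Borel measure on `S^{n-1}` determined by
`IsDualCurvatureMeasure` (its values on Borel sets are prescribed, so there is at most one). The
value `0` is a convention for sets `K` and functions `φ` for which no such measure exists. -/
def dualCurvatureMeasure (φ : ℝ → ℝ) (K : Set (E n)) : Measure (Sph n) :=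
  if h : ∃ μ : Measure (Sph n), IsDualCurvatureMeasure φ K μ then h.choose else 0

/-- Wulff shape `[f] = ⋂_{u ∈ Ω} {x : x · u ≤ f(u)}`; it depends only on `f` restricted to `Ω`. -/
def wulffShape (Ω : Set (Sph n)) (f : Sph n → ℝ) : Set (E n) :=
  ⋂ u ∈ Ω, {x : E n | inner ℝ x (u : E n) ≤ f u}

/-- The closed hemisphere centred at `v`. -/
def closedHemisphere (v : Sph n) : Set (Sph n) :=
  {u | 0 ≤ inner ℝ (u : E n) (v : E n)}

/-- The standing assumptions on `ϕ, φ : (0, ∞) → (0, ∞)` (values outside `(0, ∞)` are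
irrelevant). -/
structure OrliczPair (ϕ φ : ℝ → ℝ) : Prop where
  pos : ∀ t : ℝ, 0 < t → 0 < ϕ t
  strictAnti : StrictAntiOn ϕ (Ioi 0)
  tendsto_zero : Tendsto ϕ (𝓝[>] 0) atTop
  tendsto_infty : Tendsto ϕ atTop (𝓝 0)
  differentiable : ∀ t : ℝ, 0 < t → DifferentiableAt ℝ ϕ t
  deriv_neg : ∀ t : ℝ, 0 < t → deriv ϕ t < 0
  eq_deriv : ∀ t : ℝ, 0 < t → φ t = -deriv ϕ t * t
  continuousOn : ContinuousOn φ (Ioi 0)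

end DualOrlicz

end

/-! This is an envelope theorem integrated over the sphere. With `N_t(x) = max {x · u / h_t u : u ∈
Ω}` the gauge of `[h_t]`, the radial function is `1 / N_t`, so `log ρ_t(v)` is the minimum of `log
h_t u - log (v · u)` over the `u ∈ Ω` with `v · u > 0`. Wherever the minimiser at `t = 0` is unique,
the derivative of the minimum is that of the minimised function there, namely `g (normal v)`
(`hasDerivAt_log_radialFn`).

Any minimiser is an outer normal at the boundary point in direction `v`, and where `N_0` is
differentiable it must be the normalised gradient (`eq_normalize_gradient`). By Rademacher's theorem
and homogeneity this covers almost every `v` (`ae_differentiableAt_sphere`).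

Since `s ↦ ϕ (exp s)` has derivative `-φ (exp s)`, the integrand has derivative `-φ(ρ_0) g(normal
v)`, and a uniform bound `|log ρ_t - log ρ_0| ≤ M |t|` permits dominated convergence. The curvature
measure is the push-forward of `φ(ρ_0) du / n` under `normal`, which turns the result into the
stated integral. -/

namespace DualOrlicz

variable {n : ℕ} {Ω : Set (Sph n)} {h : Sph n → ℝ}

/-! ### The gauge and the radial function of a Wulff shape. -/

/-- The data defining a Wulff shape: a closed set of directions contained in no closed hemisphere,
and a positive continuous function on it. -/
structure IsWulffData (Ω : Set (Sph n)) (h : Sph n → ℝ) : Prop where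
  isClosed : IsClosed Ω
  nonempty : Ω.Nonempty
  not_subset_closedHemisphere : ∀ v : Sph n, ¬ Ω ⊆ closedHemisphere v
  continuousOn : ContinuousOn h Ω
  pos : ∀ u ∈ Ω, 0 < h u

/-- The function `x ↦ max {x · u / h u : u ∈ Ω}`, which is the gauge of the Wulff shape. -/
noncomputable def wulffGauge (Ω : Set (Sph n)) (h : Sph n → ℝ) (x : E n) : ℝ :=
  sSup ((fun u : Sph n => inner ℝ x (u : E n) / h u) '' Ω)

namespace IsWulffData

theorem continuousOn_quotient (H : IsWulffData Ω h) (x : E n) :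
    ContinuousOn (fun u : Sph n => inner ℝ x (u : E n) / h u) Ω :=
  ContinuousOn.div (by fun_prop) H.continuousOn fun u hu => (H.pos u hu).ne'

theorem exists_isGreatest (H : IsWulffData Ω h) (x : E n) :
    ∃ u ∈ Ω, wulffGauge Ω h x = inner ℝ x (u : E n) / h u := by
  obtain ⟨u, hu, hmax⟩ := H.isClosed.isCompact.exists_sSup_image_eq H.nonempty
    (H.continuousOn_quotient x)
  exact ⟨u, hu, hmax⟩

theorem quotient_le (H : IsWulffData Ω h) (x : E n) {u : Sph n} (hu : u ∈ Ω) :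
    inner ℝ x (u : E n) / h u ≤ wulffGauge Ω h x :=
  le_csSup (H.isClosed.isCompact.image_of_continuousOn (H.continuousOn_quotient x)).bddAbove
    (mem_image_of_mem _ hu)

theorem inner_le (H : IsWulffData Ω h) (x : E n) {u : Sph n} (hu : u ∈ Ω) :
    inner ℝ x (u : E n) ≤ wulffGauge Ω h x * h u :=
  (div_le_iff₀ (H.pos u hu)).1 (H.quotient_le x hu)

theorem wulffGauge_le_iff (H : IsWulffData Ω h) (x : E n) (c : ℝ) :
    wulffGauge Ω h x ≤ c ↔ ∀ u ∈ Ω, inner ℝ x (u : E n) ≤ c * h u := by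
  constructor
  · intro hc u hu
    exact (H.inner_le x hu).trans (mul_le_mul_of_nonneg_right hc (H.pos u hu).le)
  · intro hc
    obtain ⟨u, hu, hx⟩ := H.exists_isGreatest x
    rw [hx, div_le_iff₀ (H.pos u hu)]
    exact hc u hu

theorem wulffGauge_smul (H : IsWulffData Ω h) {c : ℝ} (hc : 0 ≤ c) (x : E n) :
    wulffGauge Ω h (c • x) = c * wulffGauge Ω h x := by
  apply le_antisymm
  · rw [H.wulffGauge_le_iff]
    intro u hu
    rw [real_inner_smul_left, mul_assoc]
    exact mul_le_mul_of_nonneg_left (H.inner_le x hu) hc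
  · obtain ⟨u, hu, hx⟩ := H.exists_isGreatest x
    have := H.quotient_le (c • x) hu
    rw [real_inner_smul_left, mul_div_assoc] at this
    rwa [hx]

/-- The hemisphere centred at `-v` misses some `u ∈ Ω`, and then `v · u > 0`. -/
theorem wulffGauge_pos (H : IsWulffData Ω h) (v : Sph n) : 0 < wulffGauge Ω h v := by
  obtain ⟨u, hu, hlt⟩ := Set.not_subset.1 (H.not_subset_closedHemisphere (-v))
  simp only [closedHemisphere, mem_ofPred_eq, not_le] at hlt
  have : 0 < inner ℝ (v : E n) (u : E n) := by
    rw [real_inner_comm]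
    simpa [inner_neg_right] using hlt
  exact (div_pos this (H.pos u hu)).trans_le (H.quotient_le _ hu)

theorem exists_pos_le (H : IsWulffData Ω h) : ∃ m > 0, ∀ u ∈ Ω, m ≤ h u := by
  obtain ⟨u, hu, hmin⟩ := H.isClosed.isCompact.exists_isMinOn H.nonempty H.continuousOn
  exact ⟨h u, H.pos u hu, fun w hw => hmin hw⟩

/-- The gauge is a supremum of linear functionals of norm `1 / h u`, at most `1 / min h`. -/
theorem exists_lipschitzWith (H : IsWulffData Ω h) :
    ∃ C, LipschitzWith C (wulffGauge Ω h) := by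
  obtain ⟨m, hm, hle⟩ := H.exists_pos_le
  refine ⟨Real.toNNReal m⁻¹, LipschitzWith.of_le_add_mul _ fun x y => ?_⟩
  rw [Real.coe_toNNReal _ (inv_nonneg.2 hm.le), H.wulffGauge_le_iff]
  intro u hu
  have h1 : inner ℝ (x - y) (u : E n) ≤ dist x y := by
    simpa [dist_eq_norm] using real_inner_le_norm (x - y) (u : E n)
  have h2 := H.inner_le y hu
  have h3 : dist x y ≤ m⁻¹ * dist x y * h u := by
    have : 1 ≤ m⁻¹ * h u := by
      rw [inv_mul_eq_div, one_le_div hm]; exact hle u hu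
    nlinarith [dist_nonneg (x := x) (y := y)]
  rw [inner_sub_left] at h1
  linarith

theorem continuous_wulffGauge (H : IsWulffData Ω h) : Continuous (wulffGauge Ω h) :=
  H.exists_lipschitzWith.choose_spec.continuous

theorem wulffShape_eq (H : IsWulffData Ω h) : wulffShape Ω h = {x | wulffGauge Ω h x ≤ 1} := by
  ext x
  simp [wulffShape, H.wulffGauge_le_iff]

theorem nonempty_sph (H : IsWulffData Ω h) : Nonempty (Sph n) := H.nonempty.to_type

theorem exists_pos_mul_norm_le (H : IsWulffData Ω h) :
    ∃ c > 0, ∀ x, c * ‖x‖ ≤ wulffGauge Ω h x := by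
  have := H.nonempty_sph
  obtain ⟨v, -, hmin⟩ := isCompact_univ.exists_isMinOn (univ_nonempty (α := Sph n))
    (f := fun v : Sph n => wulffGauge Ω h v)
    (H.continuous_wulffGauge.comp continuous_subtype_val).continuousOn
  refine ⟨wulffGauge Ω h v, H.wulffGauge_pos v, fun x => ?_⟩
  rcases eq_or_ne x 0 with rfl | hx
  · simpa using (H.wulffGauge_smul le_rfl (0 : E n)).ge
  · have hw : ‖x‖⁻¹ • x ∈ Metric.sphere (0 : E n) 1 := by
      simp [norm_smul, hx]
    have hle : wulffGauge Ω h v ≤ wulffGauge Ω h (‖x‖⁻¹ • x) :=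
      isMinOn_univ_iff.1 hmin ⟨‖x‖⁻¹ • x, hw⟩
    rw [H.wulffGauge_smul (by positivity), inv_mul_eq_div, le_div_iff₀ (by positivity)] at hle
    exact hle

theorem isConvexBodyO (H : IsWulffData Ω h) : IsConvexBodyO (wulffShape Ω h) where
  convex := by
    refine convex_iInter₂ fun u _ => ?_
    have : IsLinearMap ℝ fun x : E n => inner ℝ x (u : E n) :=
      ⟨fun x y => inner_add_left _ _ _, fun c x => real_inner_smul_left _ _ _⟩
    exact convex_halfSpace_le this _
  isCompact := by
    obtain ⟨c, hc, hle⟩ := H.exists_pos_mul_norm_le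
    refine Metric.isCompact_of_isClosed_isBounded ?_ ?_
    · rw [H.wulffShape_eq]
      exact isClosed_le H.continuous_wulffGauge continuous_const
    · refine (Metric.isBounded_closedBall (x := (0 : E n)) (r := 1 / c)).subset fun x hx => ?_
      rw [H.wulffShape_eq] at hx
      rw [mem_closedBall_zero_iff, le_div_iff₀' hc]
      exact (hle x).trans hx
  zero_mem_interior := by
    have h0 : wulffGauge Ω h 0 = 0 := by simpa using H.wulffGauge_smul le_rfl (0 : E n)
    rw [H.wulffShape_eq, mem_interior_iff_mem_nhds]
    filter_upwards [H.continuous_wulffGauge.continuousAt.eventually_lt_const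
      (h0.trans_lt zero_lt_one)] with x hx using hx.le

theorem radialFn_eq (H : IsWulffData Ω h) (v : Sph n) :
    radialFn (wulffShape Ω h) v = (wulffGauge Ω h v)⁻¹ := by
  have hv := H.wulffGauge_pos v
  have : IsGreatest {r : ℝ | r • (v : E n) ∈ wulffShape Ω h} (wulffGauge Ω h v)⁻¹ := by
    rw [H.wulffShape_eq]
    constructor
    · simp [H.wulffGauge_smul (inv_nonneg.2 hv.le), hv.ne']
    · intro r hr
      rcases le_total r 0 with h0 | h0
      · exact h0.trans (inv_nonneg.2 hv.le)
      · simp only [mem_ofPred_eq, H.wulffGauge_smul h0] at hr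
        rwa [← one_div, le_div_iff₀ hv]
  exact this.csSup_eq

theorem radialFn_pos (H : IsWulffData Ω h) (v : Sph n) : 0 < radialFn (wulffShape Ω h) v := by
  rw [H.radialFn_eq]
  exact inv_pos.2 (H.wulffGauge_pos v)

theorem continuous_radialFn (H : IsWulffData Ω h) : Continuous (radialFn (wulffShape Ω h)) := by
  rw [show radialFn (wulffShape Ω h) = fun v : Sph n => (wulffGauge Ω h v)⁻¹
    from funext fun v => H.radialFn_eq v]
  exact (H.continuous_wulffGauge.comp continuous_subtype_val).inv₀ fun v => (H.wulffGauge_pos v).ne'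

/-! ### Boundary points, supporting hyperplanes and normals. -/

theorem wulffGauge_eq_one_of_mem_frontier (H : IsWulffData Ω h) {x : E n}
    (hx : x ∈ frontier (wulffShape Ω h)) : wulffGauge Ω h x = 1 := by
  rw [H.wulffShape_eq] at hx
  exact frontier_le_subset_eq H.continuous_wulffGauge continuous_const hx

theorem mem_frontier_of_wulffGauge_eq_one (H : IsWulffData Ω h) {x : E n}
    (hx : wulffGauge Ω h x = 1) : x ∈ frontier (wulffShape Ω h) := by
  rw [H.isConvexBodyO.isCompact.isClosed.frontier_eq]
  refine ⟨by rw [H.wulffShape_eq]; exact hx.le, fun hint => ?_⟩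
  have ht : Tendsto (fun c : ℝ => c • x) (𝓝[>] 1) (𝓝 x) := by
    have : Continuous fun c : ℝ => c • x := by fun_prop
    simpa using (this.tendsto 1).mono_left nhdsWithin_le_nhds
  obtain ⟨c, hc, hc1⟩ := ((ht.eventually (mem_interior_iff_mem_nhds.1 hint)).and
    self_mem_nhdsWithin).exists
  have hc1 : 1 < c := hc1
  have hc : c • x ∈ wulffShape Ω h := hc
  rw [H.wulffShape_eq, mem_ofPred_eq, H.wulffGauge_smul (by linarith), hx] at hc
  linarith

theorem inner_le_supportFn (H : IsWulffData Ω h) (u : Sph n) {y : E n} (hy : y ∈ wulffShape Ω h) :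
    inner ℝ y (u : E n) ≤ supportFn (wulffShape Ω h) u := by
  refine le_csSup ?_ ⟨y, hy, rfl⟩
  have : {s : ℝ | ∃ x ∈ wulffShape Ω h, s = inner ℝ x (u : E n)} =
      (fun x : E n => inner ℝ x (u : E n)) '' wulffShape Ω h := by
    ext s; simp [eq_comm]
  rw [this]
  exact (H.isConvexBodyO.isCompact.image (by fun_prop)).bddAbove

theorem inner_le_supportFn_mul (H : IsWulffData Ω h) (u : Sph n) (y : E n) :
    inner ℝ y (u : E n) ≤ supportFn (wulffShape Ω h) u * wulffGauge Ω h y := by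
  rcases eq_or_ne y 0 with rfl | hy
  · have := H.wulffGauge_smul le_rfl (0 : E n)
    simp only [zero_smul, zero_mul] at this
    simp [this]
  · obtain ⟨c, hc, hle⟩ := H.exists_pos_mul_norm_le
    have hpos : 0 < wulffGauge Ω h y := (mul_pos hc (norm_pos_iff.2 hy)).trans_le (hle y)
    have := H.inner_le_supportFn u (y := (wulffGauge Ω h y)⁻¹ • y) (by
      rw [H.wulffShape_eq, mem_ofPred_eq, H.wulffGauge_smul (inv_nonneg.2 hpos.le),
        inv_mul_cancel₀ hpos.ne'])
    rwa [real_inner_smul_left, inv_mul_eq_div, div_le_iff₀ hpos] at this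

/-- Equality can fail where the constraint at `u` is inactive. -/
theorem supportFn_le (H : IsWulffData Ω h) {u : Sph n} (hu : u ∈ Ω) :
    supportFn (wulffShape Ω h) u ≤ h u := by
  have h0 : (0 : E n) ∈ wulffShape Ω h := interior_subset H.isConvexBodyO.zero_mem_interior
  refine csSup_le ⟨_, 0, h0, rfl⟩ ?_
  rintro s ⟨x, hx, rfl⟩
  exact mem_iInter₂.1 hx u hu

/-- The direction `v` lies in `α*_K(η)` iff some `u ∈ η` attains `v · u = h_K(u) N(v)`, where `N` is
the gauge of `K`. -/
theorem mem_reverseRadialGaussImage_iff (H : IsWulffData Ω h) (η : Set (Sph n)) (v : Sph n) :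
    v ∈ reverseRadialGaussImage (wulffShape Ω h) η ↔
      ∃ u ∈ η, inner ℝ (v : E n) (u : E n) =
        supportFn (wulffShape Ω h) u * wulffGauge Ω h v := by
  have hv := H.wulffGauge_pos v
  constructor
  · rintro ⟨u, hu, x, ⟨hx, hxu⟩, hvx⟩
    refine ⟨u, hu, ?_⟩
    have hxu : inner ℝ x (u : E n) = supportFn (wulffShape Ω h) u := hxu
    rw [hvx, real_inner_smul_left, H.wulffGauge_smul (by positivity), hxu,
      H.wulffGauge_eq_one_of_mem_frontier hx]
    ring
  · rintro ⟨u, hu, huv⟩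
    refine ⟨u, hu, (wulffGauge Ω h v)⁻¹ • (v : E n), ⟨?_, ?_⟩, ?_⟩
    · apply H.mem_frontier_of_wulffGauge_eq_one
      rw [H.wulffGauge_smul (inv_nonneg.2 hv.le), inv_mul_cancel₀ hv.ne']
    · simp only [supportHyperplane, mem_ofPred_eq, real_inner_smul_left, huv]
      field_simp
    · simp [norm_smul, abs_of_pos hv, smul_smul, hv.ne']

/-- At a point of differentiability of the gauge, the gradient determines the normal. -/
theorem eq_smul_gradient (H : IsWulffData Ω h) {u v : Sph n}
    (hd : DifferentiableAt ℝ (wulffGauge Ω h) v)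
    (huv : inner ℝ (v : E n) (u : E n) = supportFn (wulffShape Ω h) u * wulffGauge Ω h v) :
    0 < supportFn (wulffShape Ω h) u ∧
      (u : E n) = supportFn (wulffShape Ω h) u • gradient (wulffGauge Ω h) v := by
  set s := supportFn (wulffShape Ω h) u with hs
  -- This function is nonnegative everywhere and vanishes at `v`.
  have hmin : IsLocalMin (fun y : E n => s * wulffGauge Ω h y - inner ℝ (u : E n) y) v := by
    refine Eventually.of_forall fun y => ?_
    have := H.inner_le_supportFn_mul u y
    rw [real_inner_comm] at this
    rw [real_inner_comm] at huv
    simp only [huv]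
    linarith
  have hder := hmin.hasFDerivAt_eq_zero
    ((hd.hasFDerivAt.const_mul s).sub (innerSL ℝ (u : E n)).hasFDerivAt)
  have heq : (u : E n) = s • gradient (wulffGauge Ω h) v := by
    apply (InnerProductSpace.toDual ℝ (E n)).injective
    rw [map_smulₛₗ, gradient, LinearIsometryEquiv.apply_symm_apply]
    exact (sub_eq_zero.1 hder).symm
  refine ⟨lt_of_le_of_ne ?_ ?_, heq⟩
  · have := H.inner_le_supportFn u (interior_subset H.isConvexBodyO.zero_mem_interior)
    simpa using this
  · intro h0
    rw [← h0, zero_smul] at heq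
    exact ne_zero_of_mem_unit_sphere u heq

/-- Taking norms removes the factor `h_K(u)`, so the right side depends on `v` alone: the normal is
unique. -/
theorem eq_normalize_gradient (H : IsWulffData Ω h) {u v : Sph n}
    (hd : DifferentiableAt ℝ (wulffGauge Ω h) v)
    (huv : inner ℝ (v : E n) (u : E n) = supportFn (wulffShape Ω h) u * wulffGauge Ω h v) :
    (u : E n) = ‖gradient (wulffGauge Ω h) v‖⁻¹ • gradient (wulffGauge Ω h) v := by
  obtain ⟨hs, heq⟩ := H.eq_smul_gradient hd huv
  have hnorm := congrArg norm heq
  rw [norm_smul, Real.norm_of_nonneg hs.le, norm_eq_of_mem_sphere] at hnorm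
  rw [← eq_inv_of_mul_eq_one_left hnorm.symm]
  exact heq

/-- A maximiser is an active constraint: `h_K(u) N(v) ≤ h(u) N(v) = v · u`, and the reverse bound
always holds. -/
theorem inner_eq_of_isGreatest (H : IsWulffData Ω h) {u v : Sph n} (hu : u ∈ Ω)
    (huv : wulffGauge Ω h v = inner ℝ (v : E n) (u : E n) / h u) :
    inner ℝ (v : E n) (u : E n) = supportFn (wulffShape Ω h) u * wulffGauge Ω h v := by
  apply le_antisymm (H.inner_le_supportFn_mul u v)
  calc _ ≤ h u * wulffGauge Ω h v :=
        mul_le_mul_of_nonneg_right (H.supportFn_le hu) (H.wulffGauge_pos v).le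
    _ = _ := by rw [huv, mul_div_cancel₀ _ (H.pos u hu).ne']

end IsWulffData

/-! ### Almost everywhere differentiability on the sphere. -/

/-- A positively homogeneous Lipschitz function is differentiable at almost every point of the
sphere. -/
theorem ae_differentiableAt_sphere {N : E n → ℝ} {C : NNReal} (hN : LipschitzWith C N)
    (hom : ∀ c : ℝ, 0 ≤ c → ∀ x, N (c • x) = c * N x) :
    ∀ᵐ v : Sph n ∂(sphMeasure n), DifferentiableAt ℝ N (v : E n) := by
  have hmeas : MeasurableSet {v : Sph n | ¬ DifferentiableAt ℝ N (v : E n)} :=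
    (measurableSet_of_differentiableAt ℝ N).compl.preimage measurable_subtype_coe
  have hnull : (volume : Measure (E n)) {x | ¬ DifferentiableAt ℝ N x} = 0 :=
    ae_iff.1 hN.ae_differentiableAt
  rw [ae_iff]
  refine ((volume : Measure (E n)).toSphere_apply' hmeas).trans
    (mul_eq_zero_of_right _ (measure_mono_null ?_ hnull))
  -- By homogeneity, differentiability at `r v` passes to `v`; hence the cone over the bad
  -- directions consists of bad points.
  rintro _ ⟨r, hr, _, ⟨v, hv, rfl⟩, rfl⟩ hd
  have hr0 : 0 < r := hr.1
  refine hv ?_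
  have hfun : N = fun x => r⁻¹ * N (r • x) := by
    funext x
    rw [hom r hr0.le, inv_mul_cancel_left₀ hr0.ne']
  rw [hfun]
  have hd : DifferentiableAt ℝ N (r • (v : E n)) := hd
  exact (hd.comp (v : E n) (by fun_prop : DifferentiableAt ℝ (fun x : E n => r • x) v)).const_mul _

instance : IsFiniteMeasure (sphMeasure n) :=
  inferInstanceAs (IsFiniteMeasure (volume : Measure (E n)).toSphere)

instance : (sphMeasure n).IsOpenPosMeasure :=
  inferInstanceAs ((volume : Measure (E n)).toSphere).IsOpenPosMeasure

namespace IsWulffData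

theorem ae_differentiableAt (H : IsWulffData Ω h) :
    ∀ᵐ v : Sph n ∂(sphMeasure n), DifferentiableAt ℝ (wulffGauge Ω h) (v : E n) := by
  obtain ⟨C, hC⟩ := H.exists_lipschitzWith
  exact ae_differentiableAt_sphere hC fun c hc x => H.wulffGauge_smul hc x

/-! ### The Gauss map and the curvature measure as its push-forward. -/

/-- A choice of outer unit normal, lying in `Ω`, of the Wulff shape at its boundary point in
direction `v`. -/
noncomputable def normal (H : IsWulffData Ω h) (v : Sph n) : Sph n :=
  (H.exists_isGreatest v).choose

theorem normal_mem (H : IsWulffData Ω h) (v : Sph n) : H.normal v ∈ Ω :=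
  (H.exists_isGreatest v).choose_spec.1

theorem wulffGauge_eq_normal (H : IsWulffData Ω h) (v : Sph n) :
    wulffGauge Ω h v = inner ℝ (v : E n) (H.normal v : E n) / h (H.normal v) :=
  (H.exists_isGreatest v).choose_spec.2

theorem normal_eq (H : IsWulffData Ω h) {v : Sph n}
    (hd : DifferentiableAt ℝ (wulffGauge Ω h) v) :
    (H.normal v : E n) = ‖gradient (wulffGauge Ω h) v‖⁻¹ • gradient (wulffGauge Ω h) v :=
  H.eq_normalize_gradient hd (H.inner_eq_of_isGreatest (H.normal_mem v) (H.wulffGauge_eq_normal v))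

theorem eq_normal_of_inner_eq (H : IsWulffData Ω h) {u v : Sph n}
    (hd : DifferentiableAt ℝ (wulffGauge Ω h) v)
    (huv : inner ℝ (v : E n) (u : E n) = supportFn (wulffShape Ω h) u * wulffGauge Ω h v) :
    u = H.normal v :=
  Subtype.ext ((H.eq_normalize_gradient hd huv).trans (H.normal_eq hd).symm)

/-- The pointwise choice need not be measurable, but it agrees almost everywhere with the normalised
gradient, which is. -/
theorem aemeasurable_normal (H : IsWulffData Ω h) : AEMeasurable H.normal (sphMeasure n) := by
  rw [← (MeasurableEmbedding.subtype_coe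
    (Metric.isClosed_sphere (x := (0 : E n)) (ε := 1)).measurableSet).aemeasurable_comp_iff]
  have hg : Measurable (gradient (wulffGauge Ω h)) :=
    (InnerProductSpace.toDual ℝ (E n)).symm.continuous.measurable.comp (measurable_fderiv ℝ _)
  have hg' : Measurable fun v : Sph n => gradient (wulffGauge Ω h) v :=
    hg.comp measurable_subtype_coe
  exact ⟨fun v : Sph n => ‖gradient (wulffGauge Ω h) v‖⁻¹ • gradient (wulffGauge Ω h) v,
    hg'.norm.inv.smul hg', H.ae_differentiableAt.mono fun v hv => H.normal_eq hv⟩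

theorem reverseRadialGaussImage_ae_eq (H : IsWulffData Ω h) (η : Set (Sph n)) :
    reverseRadialGaussImage (wulffShape Ω h) η =ᵐ[sphMeasure n] H.normal ⁻¹' η := by
  filter_upwards [H.ae_differentiableAt] with v hv
  apply propext
  change v ∈ reverseRadialGaussImage (wulffShape Ω h) η ↔ H.normal v ∈ η
  rw [H.mem_reverseRadialGaussImage_iff]
  constructor
  · rintro ⟨u, hu, huv⟩
    rwa [← H.eq_normal_of_inner_eq hv huv]
  · exact fun hη => ⟨_, hη,
      H.inner_eq_of_isGreatest (H.normal_mem v) (H.wulffGauge_eq_normal v)⟩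

theorem continuous_comp_radialFn (H : IsWulffData Ω h) {f : ℝ → ℝ} (hf : ContinuousOn f (Ioi 0)) :
    Continuous fun v => f (radialFn (wulffShape Ω h) v) :=
  hf.comp_continuous H.continuous_radialFn H.radialFn_pos

/-- The image under the Gauss map of the measure with density `φ ∘ ρ / n`. -/
noncomputable def normalMeasure (H : IsWulffData Ω h) (φ : ℝ → ℝ) : Measure (Sph n) :=
  (n : ENNReal)⁻¹ • ((sphMeasure n).withDensity fun v =>
    ENNReal.ofReal (φ (radialFn (wulffShape Ω h) v))).map H.normal

theorem isDualCurvatureMeasure_normalMeasure (H : IsWulffData Ω h) (φ : ℝ → ℝ) :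
    IsDualCurvatureMeasure φ (wulffShape Ω h) (H.normalMeasure φ) := by
  intro η hη
  have hnull := H.aemeasurable_normal.nullMeasurableSet_preimage hη
  refine ⟨hnull.congr (H.reverseRadialGaussImage_ae_eq η).symm, ?_⟩
  rw [normalMeasure, Measure.smul_apply, smul_eq_mul, Measure.map_apply_of_aemeasurable
    (H.aemeasurable_normal.mono_ac (withDensity_absolutelyContinuous _ _)) hη,
    withDensity_apply₀ _ hnull, Measure.restrict_congr_set (H.reverseRadialGaussImage_ae_eq η)]

theorem dualCurvatureMeasure_eq (H : IsWulffData Ω h) (φ : ℝ → ℝ) :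
    dualCurvatureMeasure φ (wulffShape Ω h) = H.normalMeasure φ := by
  have hex : ∃ μ : Measure (Sph n), IsDualCurvatureMeasure φ (wulffShape Ω h) μ :=
    ⟨_, H.isDualCurvatureMeasure_normalMeasure φ⟩
  rw [dualCurvatureMeasure, dif_pos hex]
  ext η hη
  rw [(hex.choose_spec η hη).2, (H.isDualCurvatureMeasure_normalMeasure φ η hη).2]

theorem ne_zero (H : IsWulffData Ω h) : n ≠ 0 := by
  rintro rfl
  obtain ⟨v, -⟩ := H.nonempty
  exact ne_zero_of_mem_unit_sphere v (Subsingleton.elim _ _)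

theorem isFiniteMeasure_normalMeasure (H : IsWulffData Ω h) {φ : ℝ → ℝ}
    (hφ : ContinuousOn φ (Ioi 0)) : IsFiniteMeasure (H.normalMeasure φ) := by
  have hint : Integrable (fun v => φ (radialFn (wulffShape Ω h) v)) (sphMeasure n) :=
    (H.continuous_comp_radialFn hφ).integrable_of_hasCompactSupport (.of_compactSpace _)
  have := isFiniteMeasure_withDensity_ofReal hint.2
  exact Measure.smul_finite _ (ENNReal.inv_ne_top.2 (Nat.cast_ne_zero.2 H.ne_zero))

theorem normalMeasure_restrict (H : IsWulffData Ω h) (φ : ℝ → ℝ) :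
    (H.normalMeasure φ).restrict Ω = H.normalMeasure φ := by
  refine Measure.restrict_eq_self_of_ae_mem (Measure.ae_smul_measure ?_ _)
  refine (ae_map_iff (H.aemeasurable_normal.mono_ac (withDensity_absolutelyContinuous _ _))
    H.isClosed.measurableSet).2 (Eventually.of_forall H.normal_mem)

theorem integrableOn_normalMeasure (H : IsWulffData Ω h) {φ : ℝ → ℝ} {g : Sph n → ℝ}
    (hφ : ContinuousOn φ (Ioi 0)) (hg : ContinuousOn g Ω) :
    IntegrableOn g Ω (H.normalMeasure φ) := by
  have := H.isFiniteMeasure_normalMeasure hφ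
  exact hg.integrableOn_compact H.isClosed.isCompact

theorem setIntegral_normalMeasure (H : IsWulffData Ω h) {φ : ℝ → ℝ} {g : Sph n → ℝ}
    (hφ : ContinuousOn φ (Ioi 0))
    (hφ0 : ∀ t, 0 < t → 0 ≤ φ t) (hg : ContinuousOn g Ω) :
    ∫ u in Ω, g u ∂(H.normalMeasure φ) =
      (1 / (n : ℝ)) * ∫ v, φ (radialFn (wulffShape Ω h) v) * g (H.normal v) ∂(sphMeasure n) := by
  -- Nothing is known of `g` off `Ω`, but the measure is carried by `Ω`.
  have hgm : AEStronglyMeasurable g (H.normalMeasure φ) := by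
    rw [← H.normalMeasure_restrict]
    exact (H.integrableOn_normalMeasure hφ hg).aestronglyMeasurable
  have hc : (n : ENNReal)⁻¹ ≠ 0 := ENNReal.inv_ne_zero.2 (ENNReal.natCast_ne_top n)
  have hgm' : AEStronglyMeasurable g (((sphMeasure n).withDensity fun v =>
      ENNReal.ofReal (φ (radialFn (wulffShape Ω h) v))).map H.normal) :=
    hgm.mono_ac (Measure.absolutelyContinuous_smul hc)
  rw [H.normalMeasure_restrict, normalMeasure, integral_smul_measure, integral_map
    (H.aemeasurable_normal.mono_ac (withDensity_absolutelyContinuous _ _)) hgm',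
    integral_withDensity_eq_integral_toReal_smul
      (H.continuous_comp_radialFn hφ).measurable.ennreal_ofReal (by simp)]
  simp [ENNReal.toReal_ofReal (hφ0 _ (H.radialFn_pos _))]

end IsWulffData

/-! ### Variation of the logarithm of the radial function. -/

/-- The normal `u` of the first body is tight, `v · u = N(v) h(u)`, while `v · u ≤ N₁(v) h₁(u)`.
Exchanging the two bodies gives the bound from the other side. -/
theorem IsWulffData.log_radialFn_sub_le {h₁ : Sph n → ℝ} (H : IsWulffData Ω h)
    (H₁ : IsWulffData Ω h₁) (v : Sph n) :
    Real.log (radialFn (wulffShape Ω h₁) v) - Real.log (radialFn (wulffShape Ω h) v) ≤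
      Real.log (h₁ (H.normal v)) - Real.log (h (H.normal v)) := by
  have hu := H.normal_mem v
  have hin : inner ℝ (v : E n) (H.normal v : E n) = wulffGauge Ω h v * h (H.normal v) := by
    rw [H.wulffGauge_eq_normal v, div_mul_cancel₀ _ (H.pos _ hu).ne']
  have hle := H₁.inner_le v hu
  rw [hin] at hle
  have hlog := Real.log_le_log (mul_pos (H.wulffGauge_pos v) (H.pos _ hu)) hle
  rw [Real.log_mul (H.wulffGauge_pos v).ne' (H.pos _ hu).ne',
    Real.log_mul (H₁.wulffGauge_pos v).ne' (H₁.pos _ hu).ne'] at hlog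
  rw [H.radialFn_eq, H₁.radialFn_eq, Real.log_inv, Real.log_inv]
  linarith

theorem IsWulffData.abs_log_radialFn_sub_le {h₁ : Sph n → ℝ} (H : IsWulffData Ω h)
    (H₁ : IsWulffData Ω h₁) {A : ℝ} (hA : ∀ u ∈ Ω, |Real.log (h₁ u) - Real.log (h u)| ≤ A)
    (v : Sph n) :
    |Real.log (radialFn (wulffShape Ω h₁) v) - Real.log (radialFn (wulffShape Ω h) v)| ≤ A := by
  have h1 := H.log_radialFn_sub_le H₁ v
  have h2 := H₁.log_radialFn_sub_le H v
  have h3 := abs_le.1 (hA _ (H.normal_mem v))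
  have h4 := abs_le.1 (hA _ (H₁.normal_mem v))
  exact abs_le.2 ⟨by linarith, by linarith⟩

section Variation

variable {h : ℝ → Sph n → ℝ} {g : Sph n → ℝ}

theorem exists_abs_log_sub_le (hΩ : IsClosed Ω) (hg : ContinuousOn g Ω)
    (hunif : TendstoUniformlyOn (fun t u => (Real.log (h t u) - Real.log (h 0 u)) / t) g
      (𝓝[≠] (0 : ℝ)) Ω) :
    ∃ M : ℝ, 0 ≤ M ∧
      ∀ᶠ t in 𝓝 (0 : ℝ), ∀ u ∈ Ω, |Real.log (h t u) - Real.log (h 0 u)| ≤ M * |t| := by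
  obtain ⟨G, hG⟩ := hΩ.isCompact.exists_bound_of_continuousOn hg
  refine ⟨|G| + 1, by positivity, ?_⟩
  have := Metric.tendstoUniformlyOn_iff.1 hunif 1 one_pos
  filter_upwards [eventually_nhdsWithin_iff.1 this] with t ht u hu
  rcases eq_or_ne t 0 with rfl | h0
  · simp
  · have h1 := ht h0 u hu
    rw [← div_le_iff₀ (abs_pos.2 h0), ← abs_div]
    rw [dist_comm, Real.dist_eq] at h1
    have h2 : |g u| ≤ |G| := (hG u hu).trans (le_abs_self G)
    have h3 := abs_sub_abs_le_abs_sub ((Real.log (h t u) - Real.log (h 0 u)) / t) (g u)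
    linarith

/-- The point `w t` nearly maximises `v · u / h 0 u`, so by compactness its cluster points are
maximisers, and differentiability leaves only one. -/
theorem tendsto_normal (H : IsWulffData Ω (h 0)) (hH : ∀ᶠ t in 𝓝 0, IsWulffData Ω (h t))
    (hg : ContinuousOn g Ω)
    (hunif : TendstoUniformlyOn (fun t u => (Real.log (h t u) - Real.log (h 0 u)) / t) g
      (𝓝[≠] (0 : ℝ)) Ω) {v : Sph n} (hd : DifferentiableAt ℝ (wulffGauge Ω (h 0)) v)
    {w : ℝ → Sph n} (hw : ∀ t (H' : IsWulffData Ω (h t)), w t = H'.normal v) :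
    Tendsto w (𝓝 0) (𝓝 (H.normal v)) := by
  obtain ⟨M, -, hM⟩ := exists_abs_log_sub_le H.isClosed hg hunif
  have hlim : Tendsto (fun t => inner ℝ (v : E n) (w t : E n) / h 0 (w t)) (𝓝 0)
      (𝓝 (wulffGauge Ω (h 0) v)) := by
    -- One `M |t|` pays for replacing `N_t` by `N_0`, the other for replacing `h t` by `h 0`.
    have hlow : Tendsto (fun t => wulffGauge Ω (h 0) v * Real.exp (-(2 * (M * |t|)))) (𝓝 0)
        (𝓝 (wulffGauge Ω (h 0) v)) := by
      have hc : Continuous fun t : ℝ => wulffGauge Ω (h 0) v * Real.exp (-(2 * (M * |t|))) := by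
        fun_prop
      simpa using hc.tendsto 0
    refine tendsto_of_tendsto_of_tendsto_of_le_of_le' hlow tendsto_const_nhds ?_ ?_
    · filter_upwards [hH, hM] with t Ht hMt
      have hmem : w t ∈ Ω := hw t Ht ▸ Ht.normal_mem v
      have h1 := (abs_le.1 (H.abs_log_radialFn_sub_le Ht hMt v)).2
      have h2 := (abs_le.1 (hMt _ hmem)).1
      have hin : inner ℝ (v : E n) (w t : E n) = wulffGauge Ω (h t) v * h t (w t) := by
        rw [Ht.wulffGauge_eq_normal v, ← hw t Ht, div_mul_cancel₀ _ (Ht.pos _ hmem).ne']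
      have hN := H.wulffGauge_pos v
      have hNt := Ht.wulffGauge_pos v
      have hp := H.pos _ hmem
      have hpt := Ht.pos _ hmem
      rw [H.radialFn_eq, Ht.radialFn_eq, Real.log_inv, Real.log_inv] at h1
      rw [hin, ← Real.log_le_log_iff (by positivity) (by positivity),
        Real.log_mul hN.ne' (Real.exp_pos _).ne', Real.log_exp,
        Real.log_div (by positivity) hp.ne', Real.log_mul hNt.ne' hpt.ne']
      linarith
    · filter_upwards [hH] with t Ht
      exact H.quotient_le v (hw t Ht ▸ Ht.normal_mem v)
  have hmem : ∀ᶠ t in 𝓝 0, w t ∈ Ω := hH.mono fun t Ht => hw t Ht ▸ Ht.normal_mem v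
  refine H.isClosed.isCompact.tendsto_nhds_of_unique_mapClusterPt hmem fun u hu hcl => ?_
  have hcl' : MapClusterPt (inner ℝ (v : E n) (u : E n) / h 0 u) (𝓝 0)
      ((fun u : Sph n => inner ℝ (v : E n) (u : E n) / h 0 u) ∘ w) :=
    hcl.tendsto_comp' ((H.continuousOn_quotient v u hu).mono_left
      (inf_le_inf_left _ (tendsto_principal.2 hmem)))
  have heq : wulffGauge Ω (h 0) v = inner ℝ (v : E n) (u : E n) / h 0 u := by
    have := hcl'.clusterPt.mono hlim
    exact (eq_of_nhds_neBot this).symm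
  exact H.eq_normal_of_inner_eq hd (H.inner_eq_of_isGreatest hu heq)

theorem hasDerivAt_log_radialFn (H : IsWulffData Ω (h 0))
    (hH : ∀ᶠ t in 𝓝 0, IsWulffData Ω (h t)) (hg : ContinuousOn g Ω)
    (hunif : TendstoUniformlyOn (fun t u => (Real.log (h t u) - Real.log (h 0 u)) / t) g
      (𝓝[≠] (0 : ℝ)) Ω) {v : Sph n} (hd : DifferentiableAt ℝ (wulffGauge Ω (h 0)) v) :
    HasDerivAt (fun t => Real.log (radialFn (wulffShape Ω (h t)) v)) (g (H.normal v)) 0 := by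
  -- `normal` needs a proof of `IsWulffData`, available only near `0`; elsewhere `w t` takes the
  -- irrelevant value `v`.
  have hex : ∀ t, ∃ u, ∀ H' : IsWulffData Ω (h t), u = H'.normal v := fun t => by
    by_cases H' : IsWulffData Ω (h t)
    · exact ⟨H'.normal v, fun _ => rfl⟩
    · exact ⟨v, fun H'' => absurd H'' H'⟩
  choose w hw using hex
  have hwlim := tendsto_normal H hH hg hunif hd hw
  have hmem : ∀ᶠ t in 𝓝 0, w t ∈ Ω := hH.mono fun t Ht => hw t Ht ▸ Ht.normal_mem v
  have hu := H.normal_mem v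
  have hgw : Tendsto (fun t => g (w t)) (𝓝[≠] 0) (𝓝 (g (H.normal v))) :=
    ((hg _ hu).tendsto.comp (tendsto_nhdsWithin_iff.2 ⟨hwlim, hmem⟩)).mono_left
      nhdsWithin_le_nhds
  rw [hasDerivAt_iff_tendsto_slope, Metric.tendsto_nhds]
  intro ε hε
  filter_upwards [Metric.tendsto_nhds.1 hgw (ε / 2) (by positivity),
    Metric.tendstoUniformlyOn_iff.1 hunif (ε / 2) (by positivity),
    hmem.filter_mono nhdsWithin_le_nhds, hH.filter_mono nhdsWithin_le_nhds,
    self_mem_nhdsWithin] with t h1 h2 h3 Ht h0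
  have h0 : t ≠ 0 := h0
  have h4 := abs_lt.1 (Real.dist_eq _ _ ▸ h1)
  have h5 := abs_lt.1 (Real.dist_eq _ _ ▸ h2 _ h3)
  have h6 := abs_lt.1 (Real.dist_eq _ _ ▸ h2 _ hu)
  have h7 := H.log_radialFn_sub_le Ht v
  have h8 := Ht.log_radialFn_sub_le H v
  rw [← hw t Ht] at h8
  rw [slope_def_field, sub_zero, Real.dist_eq, abs_lt]
  -- The slope lies between the quotients of `log h` at `normal v` and at `w t`, in an order
  -- depending on the sign of `t`; both tend to `g (normal v)`.
  rcases lt_or_gt_of_ne h0 with hneg | hpos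
  · have h9 := div_le_div_of_nonpos_of_le hneg.le h7
    have h10 := div_le_div_of_nonpos_of_le hneg.le (neg_le_neg h8)
    rw [neg_sub, neg_sub] at h10
    constructor <;> linarith
  · have h9 := div_le_div_of_nonneg_right h7 hpos.le
    have h10 := div_le_div_of_nonneg_right (neg_le_neg h8) hpos.le
    rw [neg_sub, neg_sub] at h10
    constructor <;> linarith

end Variation

/-! ### Differentiation of the dual quermassintegral. -/

/-- Increments are compared with time `0` only, as differentiability is available only there;
dominated convergence applies to the quotients. -/
theorem hasDerivAt_integral_of_norm_sub_le {α : Type*} [MeasurableSpace α] {μ : Measure α}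
    {F : ℝ → α → ℝ} {F' bound : α → ℝ} (hF : ∀ᶠ t in 𝓝 0, Integrable (F t) μ)
    (hbound : ∀ᶠ t in 𝓝 0, ∀ᵐ a ∂μ, |F t a - F 0 a| ≤ bound a * |t|)
    (hbi : Integrable bound μ) (hd : ∀ᵐ a ∂μ, HasDerivAt (fun t => F t a) (F' a) 0) :
    HasDerivAt (fun t => ∫ a, F t a ∂μ) (∫ a, F' a ∂μ) 0 := by
  have hF0 : Integrable (F 0) μ := hF.self_of_nhds
  rw [hasDerivAt_iff_tendsto_slope]
  have hev : (fun t => ∫ a, (F t a - F 0 a) / t ∂μ) =ᶠ[𝓝[≠] 0]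
      slope (fun t => ∫ a, F t a ∂μ) 0 := by
    filter_upwards [hF.filter_mono nhdsWithin_le_nhds] with t ht
    rw [slope_def_field, sub_zero, integral_div, integral_sub ht hF0]
  refine Tendsto.congr' hev (tendsto_integral_filter_of_dominated_convergence bound ?_ ?_ hbi ?_)
  · filter_upwards [hF.filter_mono nhdsWithin_le_nhds] with t ht
    exact ((ht.sub hF0).div_const t).aestronglyMeasurable
  · filter_upwards [hbound.filter_mono nhdsWithin_le_nhds, self_mem_nhdsWithin] with t ht h0
    filter_upwards [ht] with a ha
    rw [Real.norm_eq_abs, abs_div]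
    exact (div_le_iff₀ (abs_pos.2 h0)).2 ha
  · filter_upwards [hd] with a ha
    simpa [hasDerivAt_iff_tendsto_slope, slope_fun_def_field] using ha

section Quermass

variable {ϕ φ : ℝ → ℝ}

theorem OrliczPair.nonneg (hϕ : OrliczPair ϕ φ) (t : ℝ) (ht : 0 < t) : 0 ≤ φ t := by
  rw [hϕ.eq_deriv t ht]
  nlinarith [hϕ.deriv_neg t ht]

theorem OrliczPair.hasDerivAt_comp_exp (hϕ : OrliczPair ϕ φ) (s : ℝ) :
    HasDerivAt (fun s => ϕ (Real.exp s)) (-φ (Real.exp s)) s := by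
  have h1 := (hϕ.differentiable _ (Real.exp_pos s)).hasDerivAt.comp s (Real.hasDerivAt_exp s)
  rw [hϕ.eq_deriv _ (Real.exp_pos s), neg_mul, neg_neg]
  exact h1

theorem IsWulffData.integrable_comp_radialFn (H : IsWulffData Ω h) {f : ℝ → ℝ}
    (hf : ContinuousOn f (Ioi 0)) :
    Integrable (fun v => f (radialFn (wulffShape Ω h) v)) (sphMeasure n) :=
  (H.continuous_comp_radialFn hf).integrable_of_hasCompactSupport (.of_compactSpace _)

theorem OrliczPair.continuousOn_left (hϕ : OrliczPair ϕ φ) : ContinuousOn ϕ (Ioi 0) :=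
  fun t ht => (hϕ.differentiable t ht).continuousAt.continuousWithinAt

theorem IsWulffData.dualQuermassintegral_pos (H : IsWulffData Ω h) (hϕ : OrliczPair ϕ φ) :
    0 < dualQuermassintegral ϕ (wulffShape Ω h) := by
  have hn : 0 < (n : ℝ) := Nat.cast_pos.2 (Nat.pos_of_ne_zero H.ne_zero)
  have hpos : ∀ v, 0 < ϕ (radialFn (wulffShape Ω h) v) := fun v => hϕ.pos _ (H.radialFn_pos v)
  have := H.nonempty_sph
  refine mul_pos (by positivity) ?_
  rw [integral_pos_iff_support_of_nonneg (fun v => (hpos v).le)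
    (H.integrable_comp_radialFn hϕ.continuousOn_left),
    Function.support_eq_univ fun v => (hpos v).ne']
  exact isOpen_univ.measure_pos _ univ_nonempty

theorem hasDerivAt_dualQuermassintegral {h : ℝ → Sph n → ℝ} {g : Sph n → ℝ}
    (hϕ : OrliczPair ϕ φ) (hH : ∀ᶠ t in 𝓝 0, IsWulffData Ω (h t)) (hg : ContinuousOn g Ω)
    (hunif : TendstoUniformlyOn (fun t u => (Real.log (h t u) - Real.log (h 0 u)) / t) g
      (𝓝[≠] (0 : ℝ)) Ω) :
    HasDerivAt (fun t => dualQuermassintegral ϕ (wulffShape Ω (h t)))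
      (-∫ u in Ω, g u ∂(dualCurvatureMeasure φ (wulffShape Ω (h 0)))) 0 := by
  have H : IsWulffData Ω (h 0) := hH.self_of_nhds
  rw [H.dualCurvatureMeasure_eq, H.setIntegral_normalMeasure hϕ.continuousOn hϕ.nonneg hg,
    ← mul_neg, ← integral_neg]
  refine HasDerivAt.const_mul _ ?_
  obtain ⟨M, hM0, hM⟩ := exists_abs_log_sub_le H.isClosed hg hunif
  -- `L` bounds `|log ρ_0|`, and once `M |t| < 1` also `log ρ_t` lies in `[-L - 1, L + 1]`. There
  -- `B` bounds `φ ∘ exp`, so the mean value inequality gives the constant `B * M`.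
  obtain ⟨L, hL⟩ := isCompact_univ.exists_bound_of_continuousOn
    (H.continuous_radialFn.log fun v => (H.radialFn_pos v).ne').continuousOn
  obtain ⟨B, hB⟩ := (isCompact_Icc (a := -L - 1) (b := L + 1)).exists_bound_of_continuousOn
    (hϕ.continuousOn.comp_continuous Real.continuous_exp Real.exp_pos).continuousOn
  have hsmall : ∀ᶠ t in 𝓝 (0 : ℝ), M * |t| < 1 := by
    have hc : Continuous fun t : ℝ => M * |t| := by fun_prop
    exact hc.continuousAt.eventually_lt_const (by simp)
  refine hasDerivAt_integral_of_norm_sub_le (bound := fun _ => B * M) ?_ ?_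
    (integrable_const _) ?_
  · exact hH.mono fun t Ht => Ht.integrable_comp_radialFn hϕ.continuousOn_left
  · filter_upwards [hH, hM, hsmall] with t Ht hMt hst
    refine Eventually.of_forall fun v => ?_
    have h1 := H.abs_log_radialFn_sub_le Ht hMt v
    have h2 := abs_le.1 (hL v (mem_univ v))
    have h3 := abs_le.1 h1
    have h4 := (convex_Icc (-L - 1) (L + 1)).norm_image_sub_le_of_norm_hasDerivWithin_le
      (fun s _ => (hϕ.hasDerivAt_comp_exp s).hasDerivWithinAt)
      (fun s hs => (norm_neg _).trans_le (hB s hs))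
      (x := Real.log (radialFn (wulffShape Ω (h 0)) v))
      (y := Real.log (radialFn (wulffShape Ω (h t)) v))
      ⟨by linarith, by linarith⟩ ⟨by linarith, by linarith⟩
    rw [Real.exp_log (H.radialFn_pos v), Real.exp_log (Ht.radialFn_pos v)] at h4
    have hB0 : 0 ≤ B := (norm_nonneg _).trans (hB (Real.log (radialFn (wulffShape Ω (h 0)) v))
      ⟨by linarith, by linarith⟩)
    calc _ ≤ _ := h4
      _ ≤ B * (M * |t|) := mul_le_mul_of_nonneg_left h1 hB0
      _ = _ := by ring
  · filter_upwards [H.ae_differentiableAt] with v hv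
    have h1 := hasDerivAt_log_radialFn H hH hg hunif hv
    have h2 := (hϕ.hasDerivAt_comp_exp _).comp 0 h1
    rw [Real.exp_log (H.radialFn_pos v), neg_mul] at h2
    refine h2.congr_of_eventuallyEq ?_
    filter_upwards [hH] with t Ht
    simp [Real.exp_log (Ht.radialFn_pos v)]

end Quermass

end DualOrlicz

theorem theorem4p1 (n : ℕ) (hn : 1 ≤ n) (ϕ φ : ℝ → ℝ) (hϕ : DualOrlicz.OrliczPair ϕ φ)
    (Ω : Set (DualOrlicz.Sph n)) (hΩ : IsClosed Ω)
    (hΩ' : ∀ v : DualOrlicz.Sph n, ¬ Ω ⊆ DualOrlicz.closedHemisphere v)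
    (g : DualOrlicz.Sph n → ℝ) (hg : ContinuousOn g Ω)
    (δ : ℝ) (hδ : 0 < δ) (h o : ℝ → DualOrlicz.Sph n → ℝ)
    (hcont : ∀ t ∈ Ioo (-δ) δ, ContinuousOn (h t) Ω)
    (hpos : ∀ t ∈ Ioo (-δ) δ, ∀ u ∈ Ω, 0 < h t u)
    (ho : TendstoUniformlyOn (fun (t : ℝ) (u : DualOrlicz.Sph n) => o t u / t) (fun _ => 0)
      (𝓝[≠] (0 : ℝ)) Ω)
    (hlog : ∀ t ∈ Ioo (-δ) δ, ∀ u ∈ Ω,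
      Real.log (h t u) = Real.log (h 0 u) + t * g u + o t u) :
    -- the objects in the formulas are well defined
    (∀ t ∈ Ioo (-δ) δ, DualOrlicz.IsConvexBodyO (DualOrlicz.wulffShape Ω (h t)) ∧
      Integrable (fun u => ϕ (DualOrlicz.radialFn (DualOrlicz.wulffShape Ω (h t)) u))
        (DualOrlicz.sphMeasure n)) ∧
    DualOrlicz.IsDualCurvatureMeasure φ (DualOrlicz.wulffShape Ω (h 0))
      (DualOrlicz.dualCurvatureMeasure φ (DualOrlicz.wulffShape Ω (h 0))) ∧
    IntegrableOn g Ω (DualOrlicz.dualCurvatureMeasure φ (DualOrlicz.wulffShape Ω (h 0))) ∧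
    0 < DualOrlicz.dualQuermassintegral ϕ (DualOrlicz.wulffShape Ω (h 0)) ∧
    -- the variational formula
    HasDerivAt (fun t => DualOrlicz.dualQuermassintegral ϕ (DualOrlicz.wulffShape Ω (h t)))
      (-∫ u in Ω, g u ∂(DualOrlicz.dualCurvatureMeasure φ (DualOrlicz.wulffShape Ω (h 0)))) 0 ∧
    -- its logarithmic form
    HasDerivAt
      (fun t => Real.log (DualOrlicz.dualQuermassintegral ϕ (DualOrlicz.wulffShape Ω (h t))))
      (-1 / DualOrlicz.dualQuermassintegral ϕ (DualOrlicz.wulffShape Ω (h 0)) *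
        ∫ u in Ω, g u ∂(DualOrlicz.dualCurvatureMeasure φ (DualOrlicz.wulffShape Ω (h 0)))) 0 := by
  have hδ0 : (0 : ℝ) ∈ Ioo (-δ) δ := ⟨by linarith, hδ⟩
  have hne : Ω.Nonempty := by
    by_contra hempty
    rw [not_nonempty_iff_eq_empty] at hempty
    -- An empty `Ω` lies in any closed hemisphere; `1 ≤ n` supplies a centre for one.
    refine hΩ' ⟨EuclideanSpace.single (⟨0, hn⟩ : Fin n) 1, by simp⟩ ?_
    simp [hempty]
  have hW : ∀ t ∈ Ioo (-δ) δ, DualOrlicz.IsWulffData Ω (h t) := fun t ht =>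
    ⟨hΩ, hne, hΩ', hcont t ht, hpos t ht⟩
  have hev : ∀ᶠ t in 𝓝 (0 : ℝ), t ∈ Ioo (-δ) δ := Ioo_mem_nhds hδ0.1 hδ0.2
  have H := hW 0 hδ0
  have hunif : TendstoUniformlyOn (fun t u => (Real.log (h t u) - Real.log (h 0 u)) / t) g
      (𝓝[≠] (0 : ℝ)) Ω := by
    rw [Metric.tendstoUniformlyOn_iff] at ho ⊢
    intro ε hε
    filter_upwards [ho ε hε, hev.filter_mono nhdsWithin_le_nhds, self_mem_nhdsWithin]
      with t h1 h2 h3 u hu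
    have h3 : t ≠ 0 := h3
    have heq : (Real.log (h t u) - Real.log (h 0 u)) / t = g u + o t u / t := by
      rw [hlog t h2 u hu]
      field_simp
      ring
    rw [heq]
    simpa using h1 u hu
  have hderiv := DualOrlicz.hasDerivAt_dualQuermassintegral hϕ (hev.mono hW) hg hunif
  have hVpos := H.dualQuermassintegral_pos hϕ
  refine ⟨fun t ht => ⟨(hW t ht).isConvexBodyO,
    (hW t ht).integrable_comp_radialFn hϕ.continuousOn_left⟩, ?_, ?_, hVpos, hderiv, ?_⟩
  · rw [H.dualCurvatureMeasure_eq]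
    exact H.isDualCurvatureMeasure_normalMeasure φ
  · rw [H.dualCurvatureMeasure_eq]
    exact H.integrableOn_normalMeasure hϕ.continuousOn hg
  · convert hderiv.log hVpos.ne' using 1
    ring
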